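/- Let $n\ge 1$, let $\mathbb{B}_n=\{z\in\mathbb{C}^n:|z_1|^2+\cdots+|z_n|^2<1\}$ with boundary sphere $\mathbb{S}_n$, let $\sigma_n$ be the normalized surface measure on $\mathbb{S}_n$ (total mass one), and let $\mathbb{D}=\mathbb{B}_1$ be the open unit disc of $\mathbb{C}$. The Hardy space $H^2(\mathbb{B}_n)$ is the space of all holomorphic $f:\mathbb{B}_n\to\mathbb{C}$ with $$\|f\|_{H^2(\mathbb{B}_n)}^2:=\sup_{0\le r<1}\int_{\mathbb{S}_n}|f(r\zeta)|^2\,d\sigma_n(\zeta)<\infty,$$ normed by $\|\cdot\|_{H^2(\mathbb{B}_n)}$; in particular $H^2(\mathbb{D})$ is the classical Hardy space of the disc. For every holomorphic function $\varphi:\mathbb{B}_n\to\mathbb{D}$, the composition operator $C_\varphi f=f\circ\varphi$ maps $H^2(\mathbb{D})$ into $H^2(\mathbb{B}_n)$ and is a bounded linear operator $C_\varphi:H^2(\mathbb{D})\to H^2(\mathbb{B}_n)$. -/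

import Mathlib

open MeasureTheory Metric Set
open scoped ENNReal

noncomputable section HardySpaceDefinitions

variable (E : Type*) [NormedAddCommGroup E] [InnerProductSpace ℂ E]

/-- The open unit ball of a complex inner product space. For `E = ℂ` it is the unit disc, for
`E = EuclideanSpace ℂ (Fin n)` it is the open Euclidean unit ball of `ℂⁿ`. -/
abbrev UnitBall : Type _ := ball (0 : E) 1

variable {E}

/-- A function on the open unit ball is holomorphic if it is the restriction of a function that is
complex (Fréchet) differentiable at every point of the ball. (The ball is open, so differentiability
at a point within the ball depends only on the values on the ball.) -/
def IsHolomorphicOnUnitBall (f : UnitBall E → ℂ) : Prop :=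
  ∃ F : E → ℂ, DifferentiableOn ℂ F (ball (0 : E) 1) ∧ ∀ z : UnitBall E, F z = f z

/-- The point `r ζ` of the open unit ball, for `0 ≤ r < 1` and `ζ` in the unit sphere. -/
def dilate (r : Ico (0 : ℝ) 1) (ζ : sphere (0 : E) 1) : UnitBall E :=
  ⟨((r : ℝ) : ℂ) • (ζ : E), by
    rw [mem_ball_zero_iff, norm_smul, norm_eq_of_mem_sphere ζ, mul_one, Complex.norm_real,
      Real.norm_eq_abs, abs_of_nonneg r.2.1]
    exact r.2.2⟩

theorem continuous_dilate (r : Ico (0 : ℝ) 1) : Continuous (dilate (E := E) r) := by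
  unfold dilate
  fun_prop

theorem IsHolomorphicOnUnitBall.continuous {f : UnitBall E → ℂ} (hf : IsHolomorphicOnUnitBall f) :
    Continuous f := by
  obtain ⟨F, hF, h⟩ := hf
  have : f = (ball (0 : E) 1).domRestrict F := funext fun z => (h z).symm
  rw [this]
  exact continuousOn_iff_continuous_domRestrict.1 hF.continuousOn

variable [FiniteDimensional ℂ E] [MeasurableSpace E] [BorelSpace E]

variable (E) in
/-- The normalized surface measure on the unit sphere of `E`: the surface measure induced by
Lebesgue measure, scaled to total mass one (so the chosen normalization of Lebesgue measure is
irrelevant). For `E = ℂ` this is normalized arc length on the unit circle. -/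
def sphereMeasure : Measure (sphere (0 : E) 1) :=
  ((Measure.addHaar : Measure E).toSphere univ)⁻¹ • (Measure.addHaar : Measure E).toSphere

/-- The square of the Hardy norm, with values in `[0, ∞]`:
`sup_{0 ≤ r < 1} ∫ |f (r ζ)|² dσ(ζ)`. -/
def hardySq (f : UnitBall E → ℂ) : ℝ≥0∞ :=
  ⨆ r : Ico (0 : ℝ) 1, ∫⁻ ζ, ‖f (dilate r ζ)‖ₑ ^ 2 ∂(sphereMeasure E)

instance sphereMeasure.isOpenPosMeasure : (sphereMeasure E).IsOpenPosMeasure :=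
  Measure.isOpenPosMeasure_smul _ (ENNReal.inv_ne_zero.2 (measure_ne_top _ _))

theorem hardySq_rpow_eq_iSup_eLpNorm (f : UnitBall E → ℂ) :
    hardySq f ^ (1 / 2 : ℝ) =
      ⨆ r : Ico (0 : ℝ) 1, eLpNorm (fun ζ => f (dilate r ζ)) 2 (sphereMeasure E) := by
  have h := (ENNReal.orderIsoRpow (1 / 2 : ℝ) (by norm_num)).map_iSup
    (fun r : Ico (0 : ℝ) 1 => ∫⁻ ζ, ‖f (dilate r ζ)‖ₑ ^ 2 ∂(sphereMeasure E))
  simp only [ENNReal.orderIsoRpow_apply] at h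
  rw [hardySq, h]
  refine iSup_congr fun r => ?_
  rw [eLpNorm_eq_lintegral_rpow_enorm_toReal two_ne_zero ENNReal.ofNat_ne_top]
  simp

theorem hardySq_add_le {f g : UnitBall E → ℂ} (hf : Continuous f) (hg : Continuous g) :
    hardySq (f + g) ^ (1 / 2 : ℝ) ≤ hardySq f ^ (1 / 2 : ℝ) + hardySq g ^ (1 / 2 : ℝ) := by
  simp only [hardySq_rpow_eq_iSup_eLpNorm]
  refine iSup_le fun r => ?_
  have h := eLpNorm_add_le (μ := sphereMeasure E) (p := 2)
    (f := fun ζ => f (dilate r ζ)) (g := fun ζ => g (dilate r ζ))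
    (hf.comp (continuous_dilate r)).aestronglyMeasurable
    (hg.comp (continuous_dilate r)).aestronglyMeasurable (by norm_num)
  refine le_trans h (add_le_add ?_ ?_)
  · exact le_iSup (fun r => eLpNorm (fun ζ => f (dilate r ζ)) 2 (sphereMeasure E)) r
  · exact le_iSup (fun r => eLpNorm (fun ζ => g (dilate r ζ)) 2 (sphereMeasure E)) r

theorem hardySq_smul (c : ℂ) (f : UnitBall E → ℂ) :
    hardySq (c • f) = ‖c‖ₑ ^ 2 * hardySq f := by
  simp only [hardySq, ENNReal.mul_iSup, Pi.smul_apply, smul_eq_mul, enorm_mul, mul_pow]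
  refine iSup_congr fun r => ?_
  exact lintegral_const_mul' _ _ (by simp)

theorem eq_zero_of_hardySq_eq_zero [Nontrivial E] {f : UnitBall E → ℂ} (hf : Continuous f)
    (h : hardySq f = 0) : f = 0 := by
  have key : ∀ (r : Ico (0 : ℝ) 1) (ζ : sphere (0 : E) 1), f (dilate r ζ) = 0 := by
    intro r
    have hr : ∫⁻ ζ, ‖f (dilate r ζ)‖ₑ ^ 2 ∂(sphereMeasure E) = 0 := by
      simpa using (iSup_eq_bot.1 h) r
    have hc : Continuous fun ζ => f (dilate r ζ) := hf.comp (continuous_dilate r)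
    rw [lintegral_eq_zero_iff (hc.enorm.measurable.pow_const 2)] at hr
    have hz : (fun ζ => f (dilate r ζ)) =ᵐ[sphereMeasure E] fun _ => (0 : ℂ) := by
      filter_upwards [hr] with ζ hζ
      simpa using hζ
    exact congrFun ((hc.ae_eq_iff_eq (sphereMeasure E) continuous_const).1 hz)
  funext z
  obtain ⟨z, hz⟩ := z
  rw [mem_ball_zero_iff] at hz
  by_cases h0 : z = 0
  · obtain ⟨ζ, hζ⟩ := exists_norm_eq E (zero_le_one (α := ℝ))
    rw [Pi.zero_apply, ← key ⟨0, le_rfl, one_pos⟩ ⟨ζ, by simpa using hζ⟩]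
    congr 1
    simp [dilate, h0]
  · have hn : ‖z‖ ≠ 0 := norm_ne_zero_iff.2 h0
    rw [Pi.zero_apply, ← key ⟨‖z‖, norm_nonneg z, hz⟩
      ⟨((‖z‖ : ℂ)⁻¹) • z, by simp [norm_smul, hn]⟩]
    congr 1
    have hn2 : (‖z‖ : ℂ) ≠ 0 := by exact_mod_cast hn
    simp [dilate, smul_smul, hn2]

variable (E) in
/-- The holomorphic functions `f` on the open unit ball with
`sup_{0 ≤ r < 1} ∫ |f (r ζ)|² dσ(ζ) < ∞`, as a subspace of all functions on the ball. -/
def hardySubmodule : Submodule ℂ (UnitBall E → ℂ) where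
  carrier := {f | IsHolomorphicOnUnitBall f ∧ hardySq f < ∞}
  zero_mem' := ⟨⟨0, differentiableOn_const 0, fun _ => rfl⟩, by simp [hardySq]⟩
  add_mem' := by
    rintro f g ⟨hf, hf2⟩ ⟨hg, hg2⟩
    refine ⟨?_, ?_⟩
    · obtain ⟨F, hF, hFf⟩ := hf
      obtain ⟨G, hG, hGg⟩ := hg
      exact ⟨F + G, hF.add hG, fun z => by simp [hFf, hGg]⟩
    · have h := (hardySq_add_le hf.continuous hg.continuous).trans_lt
        (ENNReal.add_lt_top.2 ⟨ENNReal.rpow_lt_top_of_nonneg (by norm_num) hf2.ne,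
          ENNReal.rpow_lt_top_of_nonneg (by norm_num) hg2.ne⟩)
      exact (ENNReal.rpow_lt_top_iff_of_pos (by norm_num)).1 h
  smul_mem' := by
    rintro c f ⟨hf, hf2⟩
    refine ⟨?_, ?_⟩
    · obtain ⟨F, hF, hFf⟩ := hf
      exact ⟨c • F, hF.const_smul c, fun z => by simp [hFf]⟩
    · rw [hardySq_smul]
      exact ENNReal.mul_lt_top (by simp) hf2

variable (E) in
/-- The Hardy space `H²` of the open unit ball of `E`. -/
def HardySpace : Type _ := hardySubmodule E

namespace HardySpace

instance : AddCommGroup (HardySpace E) := inferInstanceAs (AddCommGroup (hardySubmodule E))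

instance : Module ℂ (HardySpace E) := inferInstanceAs (Module ℂ (hardySubmodule E))

instance : CoeFun (HardySpace E) fun _ => UnitBall E → ℂ := ⟨Subtype.val⟩

/-- The Hardy norm `(sup_{0 ≤ r < 1} ∫ |f (r ζ)|² dσ(ζ))^{1/2}`. -/
instance : Norm (HardySpace E) := ⟨fun f => √(hardySq (f : UnitBall E → ℂ)).toReal⟩

theorem norm_def (f : HardySpace E) : ‖f‖ = √(hardySq (f : UnitBall E → ℂ)).toReal := rfl

theorem norm_eq_rpow (f : HardySpace E) :
    ‖f‖ = (hardySq (f : UnitBall E → ℂ) ^ (1 / 2 : ℝ)).toReal := by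
  rw [norm_def, Real.sqrt_eq_rpow, ENNReal.toReal_rpow]

theorem core [Nontrivial E] : NormedSpace.Core ℂ (HardySpace E) where
  norm_nonneg f := Real.sqrt_nonneg _
  norm_smul c f := by
    have h : hardySq ((c • f : HardySpace E) : UnitBall E → ℂ) =
        ‖c‖ₑ ^ 2 * hardySq (f : UnitBall E → ℂ) := hardySq_smul c f.1
    rw [norm_def, norm_def, h, ENNReal.toReal_mul, ENNReal.toReal_pow, toReal_enorm,
      Real.sqrt_mul (by positivity), Real.sqrt_sq (norm_nonneg c)]
  norm_triangle f g := by
    have hf := ENNReal.rpow_lt_top_of_nonneg (y := 1 / 2) (by norm_num) f.2.2.ne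
    have hg := ENNReal.rpow_lt_top_of_nonneg (y := 1 / 2) (by norm_num) g.2.2.ne
    rw [norm_eq_rpow, norm_eq_rpow, norm_eq_rpow, ← ENNReal.toReal_add hf.ne hg.ne]
    exact ENNReal.toReal_mono (ENNReal.add_lt_top.2 ⟨hf, hg⟩).ne
      (hardySq_add_le f.2.1.continuous g.2.1.continuous)
  norm_eq_zero_iff f := by
    constructor
    · intro h
      rw [norm_def, Real.sqrt_eq_zero ENNReal.toReal_nonneg, ENNReal.toReal_eq_zero_iff] at h
      exact Subtype.ext (eq_zero_of_hardySq_eq_zero f.2.1.continuous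
        (h.resolve_right f.2.2.ne))
    · rintro rfl
      have h : hardySq ((0 : HardySpace E) : UnitBall E → ℂ) = 0 := by
        change hardySq (0 : UnitBall E → ℂ) = 0
        simp [hardySq]
      rw [norm_def, h]
      simp

instance [Nontrivial E] : NormedAddCommGroup (HardySpace E) := NormedAddCommGroup.ofCore core

instance [Nontrivial E] : NormedSpace ℂ (HardySpace E) := NormedSpace.ofCore core

end HardySpace

end HardySpaceDefinitions

/-! This is Littlewood subordination. Since `F ^ 2` is holomorphic, `‖F w‖ ^ 2` is at most the
Poisson integral of `‖F‖ ^ 2` over a circle of radius `s < 1` (`norm_sq_le_integral_poissonKernel`).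
Put `w = Φ (r ζ)`, integrate over `ζ` and exchange the integrals. For fixed `z` on the circle, the
Poisson kernel at `Φ x` is the real part of a holomorphic function of `x`, so its mean over the
sphere is its value at `x = 0` (`integral_poissonKernel_comp`). That value is at most `(s + ‖Φ 0‖) /
(s - ‖Φ 0‖)`, which bounds the integral of `‖F ∘ Φ‖ ^ 2` by that of `‖F‖ ^ 2`
(`integral_norm_sq_comp_le`). Keeping `s` away from `‖Φ 0‖` makes the constant independent of `r`
(`hardySq_comp_le`). -/

/-! ### Invariance of the surface measure under unimodular scalars -/

open scoped Pointwise in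
theorem measurePreserving_smul_toSphere {E : Type*} [NormedAddCommGroup E] [InnerProductSpace ℂ E]
    [FiniteDimensional ℂ E] [MeasurableSpace E] [BorelSpace E] (μ : Measure E)
    [μ.IsAddHaarMeasure] (u : sphere (0 : ℂ) 1) :
    MeasurePreserving (fun ζ : sphere (0 : E) 1 => u • ζ) μ.toSphere μ.toSphere := by
  have hfd : FiniteDimensional ℝ E := FiniteDimensional.complexToReal E
  have hu : ‖(u : ℂ)‖ = 1 := norm_eq_of_mem_sphere u
  have hu0 : (u : ℂ) ≠ 0 := norm_ne_zero_iff.1 (by rw [hu]; exact one_ne_zero)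
  let f : E ≃ₗ[ℝ] E := (LinearEquiv.smulOfNeZero ℂ E (u : ℂ) hu0).restrictScalars ℝ
  have hf : ∀ x, f x = (u : ℂ) • x := fun x => rfl
  -- A linear automorphism multiplies Haar measure by a constant; the unit ball is preserved and has
  -- finite positive measure, so the constant is 1.
  have hpre : ∀ s, μ (f ⁻¹' s) = μ s := by
    intro s
    have hball : f ⁻¹' ball (0 : E) 1 = ball 0 1 := by
      ext x
      simp [hf, norm_smul, hu]
    have h := μ.addHaar_preimage_linearEquiv f (ball (0 : E) 1)
    rw [hball] at h
    have h1 : ENNReal.ofReal |LinearMap.det (f.symm : E →ₗ[ℝ] E)| = 1 := by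
      have h0 : μ (ball (0 : E) 1) ≠ 0 := (measure_ball_pos μ _ one_pos).ne'
      have ht : μ (ball (0 : E) 1) ≠ ∞ := measure_ball_lt_top.ne
      exact ((ENNReal.mul_eq_right h0 ht).1 h.symm)
    rw [μ.addHaar_preimage_linearEquiv f s, h1, one_mul]
  have hc : Continuous (fun ζ : sphere (0 : E) 1 => u • ζ) := continuous_const_smul u
  refine ⟨hc.measurable, Measure.ext fun s hs => ?_⟩
  rw [Measure.map_apply hc.measurable hs, μ.toSphere_apply' hs,
    μ.toSphere_apply' (hc.measurable hs), ← hpre (Ioo (0 : ℝ) 1 • (Subtype.val '' s))]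
  congr 2
  ext x
  simp only [mem_smul, mem_image, mem_preimage]
  constructor
  · rintro ⟨t, ht, _, ⟨ζ, hζ, rfl⟩, rfl⟩
    exact ⟨t, ht, _, ⟨u • ζ, hζ, rfl⟩, by rw [map_smul]; rfl⟩
  · rintro ⟨t, ht, _, ⟨ζ, hζ, rfl⟩, h⟩
    refine ⟨t, ht, _, ⟨u⁻¹ • ζ, by simpa using hζ, rfl⟩, f.injective ?_⟩
    rw [← h, map_smul, hf]
    change t • (u : ℂ) • ((u : ℂ)⁻¹ • (ζ : E)) = _
    rw [smul_inv_smul₀ hu0]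

/-! ### Averages over spheres and over circles -/

section Averages

variable {E : Type*} [NormedAddCommGroup E] [InnerProductSpace ℂ E]
  [FiniteDimensional ℂ E] [MeasurableSpace E] [BorelSpace E]

instance sphereMeasure.isProbabilityMeasure [Nontrivial E] :
    IsProbabilityMeasure (sphereMeasure E) := by
  refine ⟨?_⟩
  have hfd : FiniteDimensional ℝ E := FiniteDimensional.complexToReal E
  rw [sphereMeasure, Measure.smul_apply, smul_eq_mul]
  exact ENNReal.inv_mul_cancel
    (Measure.measure_univ_ne_zero.2 (Measure.toSphere_ne_zero _)) (measure_ne_top _ _)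

instance sphere.compactSpace_of_finiteDimensional_complex (x : E) (r : ℝ) :
    CompactSpace (sphere x r) :=
  have : ProperSpace E := FiniteDimensional.proper ℂ E
  inferInstance

variable (E) in
theorem measurePreserving_smul_sphereMeasure (u : sphere (0 : ℂ) 1) :
    MeasurePreserving (fun ζ : sphere (0 : E) 1 => u • ζ) (sphereMeasure E) (sphereMeasure E) :=
  (measurePreserving_smul_toSphere _ u).smul_measure _

/-- Rotating `ζ` by `exp (iθ)` does not change the left side; averaging over `θ` and applying Fubini
gives the right side. This reduces the mean value property to complex lines through 0. -/
theorem integral_sphereMeasure_eq_integral_circleAverage [Nontrivial E] {F : Type*}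
    [NormedAddCommGroup F] [NormedSpace ℝ F] [CompleteSpace F] {G : E → F} {s : ℝ}
    (hs : 0 ≤ s) (hG : ContinuousOn G (sphere 0 s)) :
    ∫ ζ : sphere (0 : E) 1, G ((s : ℂ) • (ζ : E)) ∂(sphereMeasure E) =
      ∫ ζ : sphere (0 : E) 1, Real.circleAverage (fun z => G (z • (ζ : E))) 0 s
        ∂(sphereMeasure E) := by
  have hmem : ∀ (θ : ℝ) (ζ : sphere (0 : E) 1), circleMap 0 s θ • (ζ : E) ∈ sphere (0 : E) s := by
    intro θ ζ
    simp [norm_smul, abs_of_nonneg hs]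
  have hc : Continuous (fun p : ℝ × sphere (0 : E) 1 => G (circleMap 0 s p.1 • (p.2 : E))) :=
    hG.comp_continuous (by fun_prop) fun p => hmem p.1 p.2
  have hrot : ∀ θ : ℝ, ∫ ζ : sphere (0 : E) 1, G (circleMap 0 s θ • (ζ : E)) ∂(sphereMeasure E) =
      ∫ ζ : sphere (0 : E) 1, G ((s : ℂ) • (ζ : E)) ∂(sphereMeasure E) := by
    intro θ
    let u : sphere (0 : ℂ) 1 := ⟨Complex.exp (θ * Complex.I), by simp⟩
    have hcs : Continuous fun ζ : sphere (0 : E) 1 => G ((s : ℂ) • (ζ : E)) := by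
      simpa [Function.comp_def, circleMap_zero] using hc.comp (Continuous.prodMk_right (0 : ℝ))
    rw [← (measurePreserving_smul_sphereMeasure E u).map_eq,
      integral_map (continuous_const_smul u).aemeasurable hcs.aestronglyMeasurable,
      (measurePreserving_smul_sphereMeasure E u).map_eq]
    refine integral_congr_ae (ae_of_all _ fun ζ => ?_)
    change _ = G ((s : ℂ) • Complex.exp (θ * Complex.I) • (ζ : E))
    rw [smul_smul, circleMap_zero]
  have hint : Integrable (Function.uncurry fun (θ : ℝ) (ζ : sphere (0 : E) 1) =>
      G (circleMap 0 s θ • (ζ : E)))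
      ((volume.restrict (Ioc 0 (2 * Real.pi))).prod (sphereMeasure E)) := by
    rw [← Measure.restrict_univ (μ := sphereMeasure E), Measure.prod_restrict]
    exact (hc.continuousOn.integrableOn_compact (isCompact_Icc.prod isCompact_univ)).mono_set
      (prod_mono Ioc_subset_Icc_self subset_rfl)
  simp only [Real.circleAverage, intervalIntegral.integral_of_le Real.two_pi_pos.le]
  rw [integral_smul, ← integral_integral_swap hint]
  simp only [hrot]
  rw [setIntegral_const, smul_smul]
  simp [Measure.real, Real.pi_pos.ne', mul_assoc, Real.pi_pos.le]

/-- The mean value property on spheres of `E`. -/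
theorem integral_sphereMeasure_of_differentiableAt [Nontrivial E] {G : E → ℂ} {s : ℝ}
    (hs : 0 ≤ s) (hG : ∀ x ∈ closedBall (0 : E) s, DifferentiableAt ℂ G x) :
    ∫ ζ : sphere (0 : E) 1, G ((s : ℂ) • (ζ : E)) ∂(sphereMeasure E) = G 0 := by
  rw [integral_sphereMeasure_eq_integral_circleAverage hs
    fun x hx => (hG x (sphere_subset_closedBall hx)).continuousAt.continuousWithinAt]
  have h : ∀ ζ : sphere (0 : E) 1, Real.circleAverage (fun z => G (z • (ζ : E))) 0 s = G 0 := by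
    intro ζ
    rw [circleAverage_of_differentiable_on_off_countable (s := ∅) countable_empty]
    · rw [zero_smul]
    all_goals
      rw [abs_of_nonneg hs]
      have hd : ∀ z ∈ closedBall (0 : ℂ) s, DifferentiableAt ℂ (fun z => G (z • (ζ : E))) z := by
        intro z hz
        refine (hG (z • (ζ : E)) ?_).comp z (by fun_prop)
        simpa [norm_smul] using hz
    · exact fun z hz => (hd z hz).continuousAt.continuousWithinAt
    · exact fun z hz => hd z (ball_subset_closedBall hz.1)
  simp [h]

/-- In dimension one every slice is the same circle with a shifted parameter, so the inner average
does not depend on `ζ`. -/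
theorem integral_sphereMeasure_complex {F : Type*}
    [NormedAddCommGroup F] [NormedSpace ℝ F] [CompleteSpace F] {G : ℂ → F} {s : ℝ}
    (hs : 0 ≤ s) (hG : ContinuousOn G (sphere 0 s)) :
    ∫ ζ : sphere (0 : ℂ) 1, G ((s : ℂ) * (ζ : ℂ)) ∂(sphereMeasure ℂ) =
      Real.circleAverage G 0 s := by
  have h := integral_sphereMeasure_eq_integral_circleAverage (E := ℂ) hs hG
  simp only [smul_eq_mul] at h
  rw [h]
  have h' : ∀ ζ : sphere (0 : ℂ) 1,
      Real.circleAverage (fun z => G (z * (ζ : ℂ))) 0 s = Real.circleAverage G 0 s := by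
    intro ζ
    have hζ : (ζ : ℂ) = Complex.exp ((ζ : ℂ).arg * Complex.I) := by
      have := Complex.norm_mul_exp_arg_mul_I (ζ : ℂ)
      rw [norm_eq_of_mem_sphere ζ] at this
      simpa using this.symm
    have hp : Function.Periodic (fun θ => G (circleMap 0 s θ)) (2 * Real.pi) := fun θ => by
      simp only [periodic_circleMap 0 s θ]
    have hr : ∀ θ : ℝ, circleMap 0 s θ * (ζ : ℂ) = circleMap 0 s (θ + (ζ : ℂ).arg) := by
      intro θ
      rw [circleMap_zero, circleMap_zero]
      conv_lhs => rw [hζ]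
      rw [mul_assoc, ← Complex.exp_add]
      push_cast
      ring_nf
    simp only [Real.circleAverage, hr]
    rw [intervalIntegral.integral_comp_add_right (fun θ => G (circleMap 0 s θ))]
    congr 1
    have := hp.intervalIntegral_add_eq (ζ : ℂ).arg 0
    rw [zero_add] at this
    rw [zero_add, add_comm (2 * Real.pi), this]
  simp [h']

end Averages

/-! ### The Poisson kernel of a disc -/

theorem continuousOn_poissonKernel_prod {s : ℝ} :
    ContinuousOn (fun p : ℂ × ℂ => poissonKernel 0 p.1 p.2) (ball 0 s ×ˢ sphere 0 s) := by
  simp only [poissonKernel_def]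
  refine ContinuousOn.div (by fun_prop) (by fun_prop) fun p hp => ?_
  have h1 : ‖p.1‖ < s := by simpa using hp.1
  have h2 : ‖p.2‖ = s := by simpa using hp.2
  have h3 : p.2 - p.1 ≠ 0 := fun h => by
    rw [sub_eq_zero.1 h] at h2
    exact h1.ne h2
  simpa using h3

theorem poissonKernel_zero_nonneg {s : ℝ} {w z : ℂ} (hw : w ∈ ball (0 : ℂ) s)
    (hz : z ∈ sphere (0 : ℂ) s) : 0 ≤ poissonKernel 0 w z := by
  have h1 : ‖w‖ < s := by simpa using hw
  have h2 : ‖z‖ = s := by simpa using hz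
  have h3 : ‖w‖ ^ 2 ≤ ‖z‖ ^ 2 := by gcongr; exact h2 ▸ h1.le
  rw [poissonKernel_def]
  simp only [sub_zero]
  exact div_nonneg (sub_nonneg.2 h3) (by positivity)

theorem poissonKernel_zero_le {s : ℝ} {w z : ℂ} (hw : w ∈ ball (0 : ℂ) s)
    (hz : z ∈ sphere (0 : ℂ) s) : poissonKernel 0 w z ≤ (s + ‖w‖) / (s - ‖w‖) := by
  have h := re_herglotzRieszKernel_le hz hw
  rw [poissonKernel_eq_re_herglotzRieszKernel]
  simpa [herglotzRieszKernel_def] using h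

theorem smul_mem_sphere_zero {s : ℝ} (hs : 0 ≤ s) (w : sphere (0 : ℂ) 1) :
    (s : ℂ) * (w : ℂ) ∈ sphere (0 : ℂ) s := by
  simp [abs_of_nonneg hs]

/-- The square of the modulus of a holomorphic function is dominated by its Poisson integral. -/
theorem norm_sq_le_integral_poissonKernel {F : ℂ → ℂ} {s : ℝ} (hs : 0 < s)
    (hF : DifferentiableOn ℂ F (closedBall 0 s)) {w : ℂ} (hw : w ∈ ball (0 : ℂ) s) :
    ‖F w‖ ^ 2 ≤ ∫ ζ : sphere (0 : ℂ) 1,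
      poissonKernel 0 w ((s : ℂ) * ζ) * ‖F ((s : ℂ) * ζ)‖ ^ 2 ∂(sphereMeasure ℂ) := by
  have hF2 : DiffContOnCl ℂ (fun z => F z ^ 2) (ball 0 s) := by
    refine DifferentiableOn.diffContOnCl ?_
    rw [closure_ball _ hs.ne']
    exact hF.pow 2
  have hP : ContinuousOn (poissonKernel 0 w) (sphere 0 s) :=
    continuousOn_poissonKernel_prod.comp (f := fun z => (w, z)) (by fun_prop) fun z hz => ⟨hw, hz⟩
  have hFc : ContinuousOn F (sphere 0 s) := hF.continuousOn.mono sphere_subset_closedBall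
  -- The Poisson formula is an equality for the holomorphic `F ^ 2`; taking norms, with a
  -- nonnegative kernel, gives the bound without subharmonicity.
  have h := hF2.circleAverage_poissonKernel_smul hw
  rw [← integral_sphereMeasure_complex hs.le (G := poissonKernel 0 w • fun z => F z ^ 2)
    (hP.smul (hFc.pow 2))] at h
  rw [← norm_pow, ← h]
  refine (norm_integral_le_integral_norm _).trans_eq (integral_congr_ae (ae_of_all _ fun ζ => ?_))
  have := poissonKernel_zero_nonneg hw (smul_mem_sphere_zero hs.le ζ)
  simp [abs_of_nonneg this]

/-! ### Littlewood subordination -/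

variable {E : Type*} [NormedAddCommGroup E] [InnerProductSpace ℂ E]
  [FiniteDimensional ℂ E] [MeasurableSpace E] [BorelSpace E]

/-- The Poisson kernel composed with a holomorphic function is pluriharmonic, hence has the mean
value property on spheres. -/
theorem integral_poissonKernel_comp [Nontrivial E] {Φ : E → ℂ} {r s : ℝ} (hr : 0 ≤ r)
    (hΦ : ∀ x ∈ closedBall (0 : E) r, DifferentiableAt ℂ Φ x)
    (hΦs : ∀ x ∈ closedBall (0 : E) r, Φ x ∈ ball (0 : ℂ) s) {z : ℂ}
    (hz : z ∈ sphere (0 : ℂ) s) :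
    ∫ ζ : sphere (0 : E) 1, poissonKernel 0 (Φ ((r : ℂ) • (ζ : E))) z ∂(sphereMeasure E) =
      poissonKernel 0 (Φ 0) z := by
  -- The kernel is `(z + Φ x) / (z - Φ x)`, whose denominator does not vanish because `‖Φ x‖ < s =
  -- ‖z‖`.
  have hd : ∀ x ∈ closedBall (0 : E) r,
      DifferentiableAt ℂ (fun x => herglotzRieszKernel 0 (Φ x) z) x := by
    intro x hx
    simp only [herglotzRieszKernel_def, sub_zero, div_eq_mul_inv]
    refine ((hΦ x hx).const_add z).mul (((hΦ x hx).const_sub z).inv fun h => ?_)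
    have h1 : ‖Φ x‖ < s := by simpa using hΦs x hx
    have h2 : ‖z‖ = s := by simpa using hz
    rw [sub_eq_zero.1 h] at h2
    exact h1.ne h2
  have hmem : ∀ ζ : sphere (0 : E) 1, (r : ℂ) • (ζ : E) ∈ closedBall (0 : E) r := by
    intro ζ
    simp [norm_smul, abs_of_nonneg hr]
  have hc : Continuous fun ζ : sphere (0 : E) 1 =>
      herglotzRieszKernel 0 (Φ ((r : ℂ) • (ζ : E))) z :=
    ContinuousOn.comp_continuous (s := closedBall (0 : E) r)
      (g := fun x => herglotzRieszKernel 0 (Φ x) z)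
      (fun x hx => (hd x hx).continuousAt.continuousWithinAt) (by fun_prop) hmem
  simp only [poissonKernel_eq_re_herglotzRieszKernel, Function.comp_apply]
  rw [← integral_sphereMeasure_of_differentiableAt hr hd]
  exact integral_re (𝕜 := ℂ)
    (hc.integrable_of_hasCompactSupport (HasCompactSupport.of_compactSpace _))

/-- Littlewood subordination on spheres. -/
theorem integral_norm_sq_comp_le [Nontrivial E] {F : ℂ → ℂ} {Φ : E → ℂ} {r s : ℝ} (hr : 0 ≤ r)
    (hs : 0 < s) (hF : DifferentiableOn ℂ F (closedBall 0 s))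
    (hΦ : ∀ x ∈ closedBall (0 : E) r, DifferentiableAt ℂ Φ x)
    (hΦs : ∀ x ∈ closedBall (0 : E) r, Φ x ∈ ball (0 : ℂ) s) :
    ∫ ζ : sphere (0 : E) 1, ‖F (Φ ((r : ℂ) • (ζ : E)))‖ ^ 2 ∂(sphereMeasure E) ≤
      (s + ‖Φ 0‖) / (s - ‖Φ 0‖) *
        ∫ w : sphere (0 : ℂ) 1, ‖F ((s : ℂ) * w)‖ ^ 2 ∂(sphereMeasure ℂ) := by
  have hmem : ∀ ζ : sphere (0 : E) 1, (r : ℂ) • (ζ : E) ∈ closedBall (0 : E) r := by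
    intro ζ
    simp [norm_smul, abs_of_nonneg hr]
  have hsm := fun w => smul_mem_sphere_zero hs.le w
  have hΦc : Continuous fun ζ : sphere (0 : E) 1 => Φ ((r : ℂ) • (ζ : E)) :=
    ContinuousOn.comp_continuous
      (fun x hx => (hΦ x hx).continuousAt.continuousWithinAt) (by fun_prop) hmem
  have hFc : Continuous fun w : sphere (0 : ℂ) 1 => F ((s : ℂ) * w) :=
    hF.continuousOn.comp_continuous (by fun_prop) fun w => sphere_subset_closedBall (hsm w)
  have hFΦc : Continuous fun ζ : sphere (0 : E) 1 => F (Φ ((r : ℂ) • (ζ : E))) :=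
    hF.continuousOn.comp_continuous hΦc fun ζ => ball_subset_closedBall (hΦs _ (hmem ζ))
  have hK : Continuous fun p : sphere (0 : E) 1 × sphere (0 : ℂ) 1 =>
      poissonKernel 0 (Φ ((r : ℂ) • (p.1 : E))) ((s : ℂ) * p.2) * ‖F ((s : ℂ) * p.2)‖ ^ 2 := by
    refine Continuous.mul ?_ ((hFc.comp continuous_snd).norm.pow 2)
    exact continuousOn_poissonKernel_prod.comp_continuous
      (f := fun p : sphere (0 : E) 1 × sphere (0 : ℂ) 1 =>
        (Φ ((r : ℂ) • (p.1 : E)), (s : ℂ) * (p.2 : ℂ)))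
      ((hΦc.comp continuous_fst).prodMk (by fun_prop)) fun p => ⟨hΦs _ (hmem p.1), hsm p.2⟩
  have hKi : Integrable (Function.uncurry fun (ζ : sphere (0 : E) 1) (w : sphere (0 : ℂ) 1) =>
      poissonKernel 0 (Φ ((r : ℂ) • (ζ : E))) ((s : ℂ) * w) * ‖F ((s : ℂ) * w)‖ ^ 2)
      ((sphereMeasure E).prod (sphereMeasure ℂ)) :=
    Continuous.integrable_of_hasCompactSupport hK (HasCompactSupport.of_compactSpace _)
  have h0 : Φ 0 ∈ ball (0 : ℂ) s := hΦs 0 (by simpa using hr)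
  calc
    _ ≤ ∫ ζ : sphere (0 : E) 1, ∫ w : sphere (0 : ℂ) 1,
          poissonKernel 0 (Φ ((r : ℂ) • (ζ : E))) ((s : ℂ) * w) * ‖F ((s : ℂ) * w)‖ ^ 2
          ∂(sphereMeasure ℂ) ∂(sphereMeasure E) :=
      integral_mono
        ((hFΦc.norm.pow 2).integrable_of_hasCompactSupport (HasCompactSupport.of_compactSpace _))
        hKi.integral_prod_left
        fun ζ => norm_sq_le_integral_poissonKernel hs hF (hΦs _ (hmem ζ))
    _ = ∫ w : sphere (0 : ℂ) 1, poissonKernel 0 (Φ 0) ((s : ℂ) * w) * ‖F ((s : ℂ) * w)‖ ^ 2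
          ∂(sphereMeasure ℂ) := by
      rw [integral_integral_swap hKi]
      refine integral_congr_ae (ae_of_all _ fun w => ?_)
      simp only
      rw [integral_mul_const, integral_poissonKernel_comp hr hΦ hΦs (hsm w)]
    _ ≤ ∫ w : sphere (0 : ℂ) 1, (s + ‖Φ 0‖) / (s - ‖Φ 0‖) * ‖F ((s : ℂ) * w)‖ ^ 2
          ∂(sphereMeasure ℂ) := by
      have hPc : Continuous fun w : sphere (0 : ℂ) 1 => poissonKernel 0 (Φ 0) ((s : ℂ) * w) :=
        continuousOn_poissonKernel_prod.comp_continuous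
          (f := fun w : sphere (0 : ℂ) 1 => (Φ 0, (s : ℂ) * (w : ℂ))) (by fun_prop)
          fun w => ⟨h0, hsm w⟩
      refine integral_mono
        ((hPc.mul (hFc.norm.pow 2)).integrable_of_hasCompactSupport
          (HasCompactSupport.of_compactSpace _))
        ((continuous_const.mul (hFc.norm.pow 2)).integrable_of_hasCompactSupport
          (HasCompactSupport.of_compactSpace _)) fun w => ?_
      exact mul_le_mul_of_nonneg_right (poissonKernel_zero_le h0 (hsm w)) (by positivity)
    _ = _ := integral_const_mul _ _

/-! ### Passage to Hardy norms -/

theorem lintegral_enorm_sq_eq_ofReal_integral {X : Type*} [TopologicalSpace X] [CompactSpace X]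
    [MeasurableSpace X] [OpensMeasurableSpace X] {μ : Measure X} [IsFiniteMeasure μ] {g : X → ℂ}
    (hg : Continuous g) : ∫⁻ x, ‖g x‖ₑ ^ 2 ∂μ = ENNReal.ofReal (∫ x, ‖g x‖ ^ 2 ∂μ) := by
  rw [ofReal_integral_eq_lintegral_ofReal (f := fun x => ‖g x‖ ^ 2)
    ((hg.norm.pow 2).integrable_of_hasCompactSupport (HasCompactSupport.of_compactSpace _))
    (ae_of_all _ fun x => by positivity)]
  simp only [ENNReal.ofReal_pow (norm_nonneg _), ofReal_norm]

theorem hardySq_comp_le [Nontrivial E] {f : UnitBall ℂ → ℂ} (hf : IsHolomorphicOnUnitBall f)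
    {φ : UnitBall E → UnitBall ℂ} (hφ : IsHolomorphicOnUnitBall fun z => (φ z : ℂ)) :
    hardySq (f ∘ φ) ≤
      ENNReal.ofReal (2 * (1 + ‖(φ ⟨0, mem_ball_self one_pos⟩ : ℂ)‖) /
        (1 - ‖(φ ⟨0, mem_ball_self one_pos⟩ : ℂ)‖)) * hardySq f := by
  have hproper : ProperSpace E := FiniteDimensional.proper ℂ E
  obtain ⟨F, hF, hFf⟩ := hf
  obtain ⟨Φ, hΦ, hΦφ⟩ := hφ
  set a := ‖(φ ⟨0, mem_ball_self one_pos⟩ : ℂ)‖ with ha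
  have ha0 : ‖Φ 0‖ = a := by rw [hΦφ ⟨0, mem_ball_self one_pos⟩]
  have ha1 : a < 1 := mem_ball_zero_iff.1 (φ ⟨0, mem_ball_self one_pos⟩).2
  refine iSup_le fun r => ?_
  have hsub : closedBall (0 : E) r ⊆ ball 0 1 := closedBall_subset_ball r.2.2
  have hΦd : ∀ x ∈ closedBall (0 : E) r, DifferentiableAt ℂ Φ x := fun x hx =>
    hΦ.differentiableAt (isOpen_ball.mem_nhds (hsub hx))
  obtain ⟨x₀, hx₀, hmax⟩ := (isCompact_closedBall (0 : E) r).exists_isMaxOn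
    ⟨0, by simpa using r.2.1⟩ (hΦ.continuousOn.mono hsub).norm
  have hρ : ‖Φ x₀‖ < 1 := by
    rw [hΦφ ⟨x₀, hsub hx₀⟩]
    exact mem_ball_zero_iff.1 (φ ⟨x₀, hsub hx₀⟩).2
  -- `s > ‖Φ x₀‖` puts the image of the closed `r`-ball inside the disc of radius `s`. `s > (1 + a)
  -- / 2` gives `s - a > (1 - a) / 2`, the source of the factor 2 in a constant free of `r`.
  obtain ⟨s, hs, hs1⟩ := exists_between (max_lt hρ (by linarith : (1 + a) / 2 < 1))
  have hsρ := (le_max_left _ _).trans_lt hs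
  have hsa := (le_max_right _ _).trans_lt hs
  have hs0 : 0 < s := (norm_nonneg _).trans_lt hsρ
  have hΦs : ∀ x ∈ closedBall (0 : E) r, Φ x ∈ ball (0 : ℂ) s := fun x hx => by
    rw [mem_ball_zero_iff]
    exact (hmax hx).trans_lt hsρ
  have key := integral_norm_sq_comp_le r.2.1 hs0 (hF.mono (closedBall_subset_ball hs1)) hΦd hΦs
  let s' : Ico (0 : ℝ) 1 := ⟨s, hs0.le, hs1⟩
  have hfc : Continuous fun w => f (dilate s' w) :=
    (IsHolomorphicOnUnitBall.continuous ⟨F, hF, hFf⟩).comp (continuous_dilate s')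
  have hfφc : Continuous fun ζ => (f ∘ φ) (dilate r ζ) :=
    ((IsHolomorphicOnUnitBall.continuous ⟨F, hF, hFf⟩).comp
      (continuous_induced_rng.2 (IsHolomorphicOnUnitBall.continuous ⟨Φ, hΦ, hΦφ⟩))).comp
      (continuous_dilate r)
  have e1 : ∀ ζ : sphere (0 : E) 1, F (Φ (((r : ℝ) : ℂ) • (ζ : E))) = (f ∘ φ) (dilate r ζ) := by
    intro ζ
    rw [show ((r : ℝ) : ℂ) • (ζ : E) = (dilate r ζ : E) from rfl, hΦφ, hFf]
    rfl
  have e2 : ∀ w : sphere (0 : ℂ) 1, F ((s : ℂ) * w) = f (dilate s' w) := fun w => hFf (dilate s' w)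
  simp only [e1, e2, ha0] at key
  have hC : (s + a) / (s - a) ≤ 2 * (1 + a) / (1 - a) := by
    have : 0 ≤ a := norm_nonneg _
    rw [div_le_div_iff₀ (by linarith) (by linarith)]
    nlinarith
  calc
    _ = ENNReal.ofReal (∫ ζ, ‖(f ∘ φ) (dilate r ζ)‖ ^ 2 ∂(sphereMeasure E)) :=
      lintegral_enorm_sq_eq_ofReal_integral hfφc
    _ ≤ ENNReal.ofReal (2 * (1 + a) / (1 - a) *
          ∫ w, ‖f (dilate s' w)‖ ^ 2 ∂(sphereMeasure ℂ)) :=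
      ENNReal.ofReal_le_ofReal
        (key.trans (mul_le_mul_of_nonneg_right hC (integral_nonneg fun w => by positivity)))
    _ = ENNReal.ofReal (2 * (1 + a) / (1 - a)) *
          ∫⁻ w, ‖f (dilate s' w)‖ₑ ^ 2 ∂(sphereMeasure ℂ) := by
      rw [ENNReal.ofReal_mul' (integral_nonneg fun w => by positivity),
        lintegral_enorm_sq_eq_ofReal_integral hfc]
    _ ≤ _ := by
      gcongr
      exact le_iSup (fun r => ∫⁻ w, ‖f (dilate r w)‖ₑ ^ 2 ∂(sphereMeasure ℂ)) s'

theorem IsHolomorphicOnUnitBall.comp {E : Type*} [NormedAddCommGroup E] [InnerProductSpace ℂ E]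
    {f : UnitBall ℂ → ℂ} (hf : IsHolomorphicOnUnitBall f)
    {φ : UnitBall E → UnitBall ℂ} (hφ : IsHolomorphicOnUnitBall fun z => (φ z : ℂ)) :
    IsHolomorphicOnUnitBall (f ∘ φ) := by
  obtain ⟨F, hF, hFf⟩ := hf
  obtain ⟨Φ, hΦ, hΦφ⟩ := hφ
  refine ⟨F ∘ Φ, hF.comp hΦ fun x hx => ?_, fun z => ?_⟩
  · rw [hΦφ ⟨x, hx⟩]
    exact (φ ⟨x, hx⟩).2
  · rw [Function.comp_apply, hΦφ, hFf, Function.comp_apply]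

theorem corollary4p3 (n : ℕ) [NeZero n]
    (φ : UnitBall (EuclideanSpace ℂ (Fin n)) → UnitBall ℂ)
    (hφ : IsHolomorphicOnUnitBall fun z => (φ z : ℂ)) :
    ∃ T : HardySpace ℂ →L[ℂ] HardySpace (EuclideanSpace ℂ (Fin n)),
      ∀ (f : HardySpace ℂ) (z : UnitBall (EuclideanSpace ℂ (Fin n))), T f z = f (φ z) := by
  obtain ⟨C, hC⟩ : ∃ C : ℝ, ∀ f : HardySpace ℂ,
      hardySq ((f : UnitBall ℂ → ℂ) ∘ φ) ≤ ENNReal.ofReal C * hardySq (f : UnitBall ℂ → ℂ) :=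
    ⟨_, fun f => hardySq_comp_le f.2.1 hφ⟩
  have hfin : ∀ f : HardySpace ℂ, ENNReal.ofReal C * hardySq (f : UnitBall ℂ → ℂ) < ∞ :=
    fun f => ENNReal.mul_lt_top ENNReal.ofReal_lt_top f.2.2
  let T : HardySpace ℂ →ₗ[ℂ] HardySpace (EuclideanSpace ℂ (Fin n)) :=
    { toFun := fun f => ⟨(f : UnitBall ℂ → ℂ) ∘ φ, f.2.1.comp hφ, (hC f).trans_lt (hfin f)⟩
      map_add' := fun f g => rfl
      map_smul' := fun c f => rfl }
  -- `ENNReal.ofReal` truncates at 0, so `max C 0` is what `toReal` returns; the sign of `C` need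
  -- not be known.
  refine ⟨T.mkContinuous √(max C 0) fun f => ?_, fun f z => rfl⟩
  rw [HardySpace.norm_def, HardySpace.norm_def, ← Real.sqrt_mul (le_max_right _ _)]
  refine Real.sqrt_le_sqrt ?_
  have h := ENNReal.toReal_mono (hfin f).ne (hC f)
  rwa [ENNReal.toReal_mul, ENNReal.toReal_ofReal'] at h
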